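/- Fix integers $k,p\ge 0$ and a real number $M$. Let $P$ be a Borel probability measure on $\mathbb R^p$ with $P([-M,M]^p)=1$. Let $\Psi:\mathbb R_{\ge 0}^k\to\mathbb R_{\ge 0}$ be componentwise non-decreasing with $\Psi(\mathbf 0)=0$, and Lipschitz: there is $\tau$ with $|\Psi(x)-\Psi(y)|\le\tau\|x-y\|_1$ for all $x,y\in\mathbb R^k_{\ge0}$ (for instance $\Psi(x)=\min_j x_j$, which gives $k$-means). Let $d_\phi(x,y)=\phi(x)-\phi(y)-\langle\nabla\phi(y),x-y\rangle$ be the Bregman divergence of $\phi(u)=\|u\|_2^2$, that is $d_\phi(x,y)=\|x-y\|_2^2$. For $\Theta=(\theta_1,\dots,\theta_k)\in(\mathbb R^p)^k$ put $$f_\Theta(x)=\Psi\big(d_\phi(x,\theta_1),\dots,d_\phi(x,\theta_k)\big),\qquad Pf_\Theta=\int f_\Theta\,dP,$$ and let $\Theta^*$ be a minimizer of $\Theta\mapsto Pf_\Theta$ over $(\mathbb R^p)^k$. For each $n$ let $X_1,\dots,X_n$ be data points in $\mathbb R^p$ (they may depend on $n$), and let $\{1,\dots,n\}=\mathcal I\sqcup\mathcal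 O$ be a non-random splitting into inliers and outliers, depending on $n$. The inliers $(X_i)_{i\in\mathcal I}$ are i.i.d. with law $P$; nothing at all is assumed about the outliers $(X_i)_{i\in\mathcal O}$. Let $B_1,\dots,B_L\subseteq\{1,\dots,n\}$, where $L=L_n$, be disjoint non-random blocks with exactly $b=\lfloor n/L\rfloor$ elements each (a partition of $\{1,\dots,n\}$ if $L$ divides $n$), and let $$\mathrm{MoM}^n_L(\Theta)=\mathrm{Median}\Big(\tfrac1b\sum_{i\in B_1}f_\Theta(X_i),\dots,\tfrac1b\sum_{i\in B_L}f_\Theta(X_i)\Big),$$ where the median of an even number of values is the average of the two middle ones. Let $\widehat\Theta_n\in([-M,M]^p)^k$ be, for every outcome, a minimizer of $\mathrm{MoM}^n_L$ over $([-M,M]^p)^k$. Assume that there is $\eta>0$ such that $L>(2+\eta)|\mathcal O|$ for all sufficiently large $n$, and that $L\to\infty$ and $L=o(n)$ as $n\to\infty$. Then $$\big|Pf_{\widehat\Theta_n}-Pf_{\Theta^*}\big|=O_{\mathbb P}\Big(\max\Big\{\sqrt{L/n},\ \sqrt{|\mathcal I|}/n\Big\}\Big)\qquad\text{and}\qquad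 Pf_{\widehat\Theta_n}\to Pf_{\Theta^*}\ \text{in probability}.$$ Here $Y_n=O_{\mathbb P}(a_n)$ means that for every $\varepsilon>0$ there is $C$ with $\mathbb P(|Y_n|>C|a_n|)\le\varepsilon$ for all sufficiently large $n$. Let $\mathrm{diss}(\Theta,\Theta')=\min_{\sigma\in S_k}\big(\sum_{j=1}^k\|\theta_j-\theta'_{\sigma(j)}\|_2^2\big)^{1/2}$. If moreover for every $\eta>0$ there is $\epsilon>0$ such that $Pf_\Theta>Pf_{\Theta^*}+\epsilon$ whenever $\mathrm{diss}(\Theta,\Theta^*)>\eta$, then $\widehat\Theta_n\to\Theta^*$ in probability, in the sense that $\mathrm{diss}(\widehat\Theta_n,\Theta^*)\to0$ in probability. -/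

import Mathlib

open MeasureTheory ProbabilityTheory Filter Topology Asymptotics

noncomputable section

/-- The Bregman divergence `d_φ(x, y) = φ(x) - φ(y) - ⟨∇φ(y), x - y⟩`. -/
def bregmanDiv {E : Type*} [NormedAddCommGroup E] [InnerProductSpace ℝ E] [CompleteSpace E]
    (φ : E → ℝ) (x y : E) : ℝ :=
  φ x - φ y - inner ℝ (gradient φ y) (x - y)

/-- The generator `φ(u) = ‖u‖₂²` gives the squared Euclidean distance. -/
theorem bregmanDiv_normSq {E : Type*} [NormedAddCommGroup E] [InnerProductSpace ℝ E]
    [CompleteSpace E] (x y : E) :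
    bregmanDiv (fun u : E => ‖u‖ ^ 2) x y = ‖x - y‖ ^ 2 := by
  have h : gradient (fun u : E => ‖u‖ ^ 2) y = (2 : ℝ) • y := by
    apply HasGradientAt.gradient
    rw [hasGradientAt_iff_hasFDerivAt]
    refine (hasStrictFDerivAt_norm_sq y).hasFDerivAt.congr_fderiv ?_
    ext z
    simp
  simp only [bregmanDiv, h, inner_smul_left, inner_sub_right, norm_sub_sq_real,
    real_inner_self_eq_norm_sq, real_inner_comm x y]
  simp
  ring

/-- The loss `f_Θ(x) = Ψ(d_φ(x, θ₁), …, d_φ(x, θ_k))` of the centroids `Θ = (θ₁, …, θ_k)`. -/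
def clusterLoss {k p : ℕ} (φ : EuclideanSpace ℝ (Fin p) → ℝ) (Ψ : (Fin k → ℝ) → ℝ)
    (Θ : Fin k → EuclideanSpace ℝ (Fin p)) (x : EuclideanSpace ℝ (Fin p)) : ℝ :=
  Ψ fun j => bregmanDiv φ x (Θ j)

/-- The population risk `P f_Θ = ∫ f_Θ dP`. -/
def populationRisk {k p : ℕ} (P : Measure (EuclideanSpace ℝ (Fin p)))
    (φ : EuclideanSpace ℝ (Fin p) → ℝ) (Ψ : (Fin k → ℝ) → ℝ)
    (Θ : Fin k → EuclideanSpace ℝ (Fin p)) : ℝ :=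
  ∫ x, clusterLoss φ Ψ Θ x ∂P

/-- `Ψ : ℝ^k_{≥0} → ℝ_{≥0}` is componentwise non-decreasing, vanishes at the origin and is
Lipschitz for the `ℓ¹` norm. Only the values of `Ψ` on the nonnegative orthant matter. -/
structure IsAggregation {k : ℕ} (Ψ : (Fin k → ℝ) → ℝ) : Prop where
  nonneg : ∀ x, 0 ≤ x → 0 ≤ Ψ x
  mono : ∀ x y, 0 ≤ x → x ≤ y → Ψ x ≤ Ψ y
  zero : Ψ 0 = 0
  lipschitz : ∃ τ : ℝ, ∀ x y, 0 ≤ x → 0 ≤ y → |Ψ x - Ψ y| ≤ τ * ∑ j, |x j - y j|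

/-- The cube `[-M, M]^p`. -/
def cube (p : ℕ) (M : ℝ) : Set (EuclideanSpace ℝ (Fin p)) :=
  {x | ∀ i, x i ∈ Set.Icc (-M) M}

/-- The median of `v₁, …, v_L`: the middle order statistic if `L` is odd, the average of the
two middle order statistics if `L` is even (and `0` if `L = 0`). -/
def median : {L : ℕ} → (Fin L → ℝ) → ℝ
  | 0, _ => 0
  | L + 1, v =>
    (v (Tuple.sort v ⟨L / 2, by omega⟩) + v (Tuple.sort v ⟨(L + 1) / 2, by omega⟩)) / 2

/-- `B₁, …, B_L` are disjoint blocks of `{1, …, n}` with exactly `b = ⌊n / L⌋` elements each;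
they form a partition of `{1, …, n}` when `L` divides `n`, and otherwise leave out fewer than
`L` indices. -/
structure IsBlocking {n L : ℕ} (B : Fin L → Finset (Fin n)) : Prop where
  disjoint : Pairwise fun l m => Disjoint (B l) (B m)
  card_eq : ∀ l, (B l).card = n / L

/-- The median-of-means objective: the median over `l` of `(1 / b) ∑_{i ∈ B_l} f_Θ(x_i)`,
where `b` is the common cardinality of the blocks. -/
def medianOfMeans {k p n L : ℕ} (φ : EuclideanSpace ℝ (Fin p) → ℝ) (Ψ : (Fin k → ℝ) → ℝ)
    (B : Fin L → Finset (Fin n)) (x : Fin n → EuclideanSpace ℝ (Fin p))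
    (Θ : Fin k → EuclideanSpace ℝ (Fin p)) : ℝ :=
  median fun l => (1 / ((B l).card : ℝ)) * ∑ i ∈ B l, clusterLoss φ Ψ Θ (x i)

/-- The dissimilarity `min_σ ‖Θ₁ - σ Θ₂‖_F` of two systems of centroids, where `σ` permutes
the rows of `Θ₂` and `‖·‖_F` is the Frobenius norm. -/
def diss {k p : ℕ} (Θ₁ Θ₂ : Fin k → EuclideanSpace ℝ (Fin p)) : ℝ :=
  ⨅ σ : Equiv.Perm (Fin k), √(∑ j, ‖Θ₁ j - Θ₂ (σ j)‖ ^ 2)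

/-- `X_n = O_P(a_n)`: the sequence `X_n / a_n` is stochastically bounded. -/
def IsBigOInProbability {Ω : Type*} [MeasurableSpace Ω] (μ : Measure Ω)
    (X : ℕ → Ω → ℝ) (a : ℕ → ℝ) : Prop :=
  ∀ ε : ℝ, 0 < ε → ∃ C : ℝ, ∀ᶠ n in atTop,
    μ {ω | C * |a n| < |X n ω|} ≤ ENNReal.ofReal ε

/-- The points `X_i`, `i ∈ I`, are independent with common law `P`. -/
structure IsIIDOn {Ω E ι : Type*} [MeasurableSpace Ω] [MeasurableSpace E] (μ : Measure Ω)
    (P : Measure E) (I : Finset ι) (X : ι → Ω → E) : Prop where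
  measurable : ∀ i ∈ I, Measurable (X i)
  map_eq : ∀ i ∈ I, μ.map (X i) = P
  indep : iIndepFun (fun (i : I) => X i) μ

end

/-! A median of block means can be off by more than `t` only if at least half of the block means are
off by more than `t`. Since `|𝒪| < L / (2 + η)` and the blocks are disjoint, the outliers spoil too
few blocks to account for that half: at least `η / (2 (2 + η)) * L` clean blocks must deviate. For a
clean block, let the bad event be that some `Θ` in the cube deviates by more than `C / √b`. This
event does not depend on `Θ`, so Markov's inequality for the number of bad events controls all `Θ`
at once, and independence between blocks is not needed
(`measure_exists_lt_abs_medianOfMeans_sub_le`).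

The bad event of one block has small probability by chaining: the loss is Lipschitz in `Θ`, which
ranges over a bounded subset of a finite-dimensional space, so the centred sums over a block are
uniformly `O(√b)` (`exists_uniform_centeredSum_bound`).

Finally, if the objective is within `r` of the risk uniformly on the cube, its minimizer has risk at
most `2r` above that of any competitor in the cube. Clamping `Θstar` to the cube gives a competitor
no worse than `Θstar` (`exists_mem_cube_populationRisk_le`). As `1 / √b ≤ 2 √(L / n)`, the first
term of the maximum already bounds the error; consistency follows from the rate. -/

/-! ### Robustness of the median. -/

section Median

theorem median_succ {L : ℕ} (v : Fin (L + 1) → ℝ) :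
    median v =
      (v (Tuple.sort v ⟨L / 2, by omega⟩) + v (Tuple.sort v ⟨(L + 1) / 2, by omega⟩)) / 2 := rfl

/-- At least half of the entries exceed any number below the median. -/
theorem le_two_mul_card_of_lt_median {L : ℕ} (v : Fin L → ℝ) {t : ℝ} (h : t < median v) :
    L ≤ 2 * (Finset.univ.filter fun l => t < v l).card := by
  cases L with
  | zero => simp
  | succ L =>
    rw [median_succ] at h
    have hm := Tuple.monotone_sort v
    have h1 : v (Tuple.sort v ⟨L / 2, by omega⟩) ≤ v (Tuple.sort v ⟨(L + 1) / 2, by omega⟩) :=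
      hm (Fin.mk_le_mk.2 (by omega))
    -- The average of the two middle values is at most the upper one, so `t` lies below the order
    -- statistics from index `(L + 1) / 2` on, which are at least half of all `L + 1`.
    have hsub : (Finset.Ici (⟨(L + 1) / 2, by omega⟩ : Fin (L + 1))).map
        (Tuple.sort v).toEmbedding ⊆ Finset.univ.filter fun l => t < v l := by
      intro l hl
      obtain ⟨m, hm', rfl⟩ := Finset.mem_map.1 hl
      have h2 := hm (Finset.mem_Ici.1 hm')
      simp only [Function.comp_apply] at h2
      simp only [Equiv.coe_toEmbedding, Finset.mem_filter, Finset.mem_univ, true_and]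
      linarith
    have hc := Finset.card_le_card hsub
    rw [Finset.card_map, Fin.card_Ici] at hc
    dsimp only at hc
    omega

/-- At least half of the entries lie below any number above the median. -/
theorem le_two_mul_card_of_median_lt {L : ℕ} (v : Fin L → ℝ) {t : ℝ} (h : median v < t) :
    L ≤ 2 * (Finset.univ.filter fun l => v l < t).card := by
  cases L with
  | zero => simp
  | succ L =>
    rw [median_succ] at h
    have hm := Tuple.monotone_sort v
    have h1 : v (Tuple.sort v ⟨L / 2, by omega⟩) ≤ v (Tuple.sort v ⟨(L + 1) / 2, by omega⟩) :=
      hm (Fin.mk_le_mk.2 (by omega))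
    have hsub : (Finset.Iic (⟨L / 2, by omega⟩ : Fin (L + 1))).map
        (Tuple.sort v).toEmbedding ⊆ Finset.univ.filter fun l => v l < t := by
      intro l hl
      obtain ⟨m, hm', rfl⟩ := Finset.mem_map.1 hl
      have h2 := hm (Finset.mem_Iic.1 hm')
      simp only [Function.comp_apply] at h2
      simp only [Equiv.coe_toEmbedding, Finset.mem_filter, Finset.mem_univ, true_and]
      linarith
    have hc := Finset.card_le_card hsub
    rw [Finset.card_map, Fin.card_Iic] at hc
    dsimp only at hc
    omega

theorem le_two_mul_card_of_lt_abs_median_sub {L : ℕ} (v : Fin L → ℝ) {t c : ℝ}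
    (h : t < |median v - c|) :
    L ≤ 2 * (Finset.univ.filter fun l => t < |v l - c|).card := by
  rcases lt_abs.1 h with h | h
  · refine (le_two_mul_card_of_lt_median v (t := c + t) (by linarith)).trans ?_
    refine Nat.mul_le_mul_left 2 (Finset.card_le_card (Finset.monotone_filter_right _ ?_))
    exact fun l _ hl => lt_abs.2 (Or.inl (by linarith))
  · refine (le_two_mul_card_of_median_lt v (t := c - t) (by linarith)).trans ?_
    refine Nat.mul_le_mul_left 2 (Finset.card_le_card (Finset.monotone_filter_right _ ?_))
    exact fun l _ hl => lt_abs.2 (Or.inr (by linarith))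

end Median

/-! ### Counting bad events. -/

/-- Markov's inequality for the number of events that occur. -/
theorem measure_le_card_filter_mem_le {Ω ι : Type*} [MeasurableSpace Ω] (μ : Measure Ω)
    [Fintype ι] (E : ι → Set Ω) [∀ ω, DecidablePred fun l => ω ∈ E l] {δ ε : ℝ} (hδ : 0 < δ)
    (hE : ∀ l, μ (E l) ≤ ENNReal.ofReal (δ * ε)) (hι : 0 < Fintype.card ι) :
    μ {ω | δ * Fintype.card ι ≤ ((Finset.univ.filter fun l => ω ∈ E l).card : ℝ)} ≤
      ENNReal.ofReal ε := by
  classical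
  -- The events will be existential over uncountably many centroids, so they are replaced by
  -- measurable hulls of the same measure.
  set g : Ω → ENNReal := fun ω => ∑ l, (toMeasurable μ (E l)).indicator 1 ω with hg
  have hgm : Measurable g := Finset.measurable_sum _ fun l _ =>
    measurable_one.indicator (measurableSet_toMeasurable _ _)
  have hint : ∫⁻ ω, g ω ∂μ ≤ ENNReal.ofReal (δ * Fintype.card ι) * ENNReal.ofReal ε := by
    rw [hg, lintegral_finsetSum _ fun l _ =>
      measurable_one.indicator (measurableSet_toMeasurable _ _)]
    simp_rw [lintegral_indicator_one (measurableSet_toMeasurable _ _), measure_toMeasurable]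
    refine (Finset.sum_le_sum fun l _ => hE l).trans ?_
    rw [Finset.sum_const, Finset.card_univ, nsmul_eq_mul, ENNReal.ofReal_mul hδ.le,
      ENNReal.ofReal_mul hδ.le, ENNReal.ofReal_natCast]
    exact le_of_eq (by ring)
  have hsub : {ω | δ * Fintype.card ι ≤ ((Finset.univ.filter fun l => ω ∈ E l).card : ℝ)} ⊆
      {ω | ENNReal.ofReal (δ * Fintype.card ι) ≤ g ω} := by
    intro ω hω
    simp only [Set.mem_ofPred_eq] at hω ⊢
    refine (ENNReal.ofReal_le_ofReal hω).trans ?_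
    rw [ENNReal.ofReal_natCast, Finset.card_filter]
    push_cast
    refine Finset.sum_le_sum fun l _ => ?_
    by_cases h : ω ∈ E l
    · simp [h, subset_toMeasurable μ (E l) h]
    · simp [h]
  have hpos : 0 < δ * Fintype.card ι := by positivity
  refine (measure_mono hsub).trans ?_
  have h := (mul_meas_ge_le_lintegral hgm (ENNReal.ofReal (δ * Fintype.card ι))).trans hint
  exact (ENNReal.mul_le_mul_iff_right (by simpa using hpos) ENNReal.ofReal_ne_top).1 h

/-! ### I.i.d. samples and Hoeffding's inequality. -/

section Sample

variable {Ω E ι : Type*} [MeasurableSpace Ω] [MeasurableSpace E] {μ : Measure Ω} {P : Measure E}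

theorem IsIIDOn.subset {I J : Finset ι} {X : ι → Ω → E} (h : IsIIDOn μ P I X) (hJ : J ⊆ I) :
    IsIIDOn μ P J X where
  measurable i hi := h.measurable i (hJ hi)
  map_eq i hi := h.map_eq i (hJ hi)
  indep := h.indep.precomp (g := fun i : J => (⟨i, hJ i.2⟩ : I)) fun _ _ hij =>
    Subtype.ext (Subtype.mk.inj hij)

theorem IsIIDOn.ae_mem {I : Finset ι} {X : ι → Ω → E} (h : IsIIDOn μ P I X) {A : Set E}
    (hA : ∀ᵐ x ∂P, x ∈ A) : ∀ᵐ ω ∂μ, ∀ i ∈ I, X i ω ∈ A := by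
  refine (eventually_all_finset I).2 fun i hi => ?_
  have := hA
  rw [← h.map_eq i hi] at this
  exact ae_of_ae_map (h.measurable i hi).aemeasurable this

/-- **Hoeffding's inequality** for a bounded function of an i.i.d. sample, with the Gaussian tail
replaced by an exponential one. -/
theorem IsIIDOn.measure_le_abs_sum_sub_integral_le [IsProbabilityMeasure μ] {s : Finset ι}
    {X : ι → Ω → E} (h : IsIIDOn μ P s X) (hs : s.Nonempty) {g : E → ℝ} (hg : Measurable g)
    {a : ℝ} (ha : 0 < a) (hga : ∀ᵐ x ∂P, |g x| ≤ a) {u : ℝ} (hu : 0 ≤ u) :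
    μ {ω | a * u * √s.card ≤ |∑ i ∈ s, (g (X i ω) - ∫ x, g x ∂P)|} ≤
      ENNReal.ofReal (4 * Real.exp (-u)) := by
  lift a to NNReal using ha.le
  set Y : s → Ω → ℝ := fun i ω => g (X i ω) - ∫ x, g x ∂P with hY
  have hcard : (0 : ℝ) < s.card := by exact_mod_cast hs.card_pos
  have hind : iIndepFun Y μ :=
    h.indep.comp (fun _ x => g x - ∫ x, g x ∂P) fun _ => hg.sub_const _
  have hsub : ∀ i : s, HasSubgaussianMGF (Y i) (a ^ 2) μ := by
    intro i
    have hmi := h.measurable i i.2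
    have hmean : ∫ ω, g (X i ω) ∂μ = ∫ x, g x ∂P := by
      rw [← h.map_eq i i.2, integral_map hmi.aemeasurable hg.aestronglyMeasurable]
    have := hasSubgaussianMGF_of_mem_Icc (μ := μ) (X := fun ω => g (X i ω)) (a := -(a : ℝ)) (b := a)
      (hg.comp hmi).aemeasurable (by
        have := hga
        rw [← h.map_eq i i.2] at this
        filter_upwards [ae_of_ae_map hmi.aemeasurable this] with ω hω
        exact abs_le.1 hω)
    rw [hmean] at this
    convert this using 2
    ext
    simp only [NNReal.coe_div, coe_nnnorm, Real.norm_eq_abs, NNReal.coe_ofNat]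
    rw [abs_of_pos (by linarith)]
    ring
  have hε : 0 ≤ a * u * √s.card := by positivity
  -- The variance proxies sum to `s.card * a ^ 2`, so the exponent is `-u ^ 2 / 2 ≤ 1 / 2 - u`, and
  -- `exp (1 / 2) ≤ 2`.
  have hexp : Real.exp (-(a * u * √s.card) ^ 2 / (2 * ∑ i : s, (a ^ 2 : NNReal)))
      ≤ 2 * Real.exp (-u) := by
    have h1 : -(a * u * √s.card) ^ 2 / (2 * ∑ i : s, ((a ^ 2 : NNReal) : ℝ)) =
        -(u ^ 2 / 2) := by
      rw [Finset.sum_const, Finset.card_univ, Fintype.card_coe, mul_pow, mul_pow,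
        Real.sq_sqrt hcard.le]
      simp only [nsmul_eq_mul, NNReal.coe_pow]
      field_simp
    push_cast at h1 ⊢
    rw [h1]
    have h2 : Real.exp (1 / 2) ≤ 2 := by
      have h3 : Real.exp (1 / 2) ^ 2 = Real.exp 1 := by rw [← Real.exp_nat_mul]; norm_num
      nlinarith [Real.exp_one_lt_d9, Real.exp_pos (1 / 2)]
    calc Real.exp (-(u ^ 2 / 2)) ≤ Real.exp (1 / 2 + -u) :=
          Real.exp_le_exp.2 (by nlinarith [sq_nonneg (u - 1)])
      _ = Real.exp (1 / 2) * Real.exp (-u) := Real.exp_add _ _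
      _ ≤ 2 * Real.exp (-u) := by gcongr
  have hup := HasSubgaussianMGF.measure_sum_ge_le_of_iIndepFun hind (s := Finset.univ)
    (fun i _ => hsub i) hε
  have hneg : iIndepFun (fun i => -Y i) μ := hind.comp (fun _ x => -x) fun _ => measurable_neg
  have hlo := HasSubgaussianMGF.measure_sum_ge_le_of_iIndepFun hneg (s := Finset.univ)
    (fun i _ => (hsub i).neg) hε
  have hset : {ω | a * u * √s.card ≤ |∑ i ∈ s, (g (X i ω) - ∫ x, g x ∂P)|} ⊆
      {ω | a * u * √s.card ≤ ∑ i : s, Y i ω} ∪ {ω | a * u * √s.card ≤ ∑ i : s, (-Y i) ω} := by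
    intro ω hω
    have he : ∑ i ∈ s, (g (X i ω) - ∫ x, g x ∂P) = ∑ i : s, Y i ω :=
      (Finset.sum_coe_sort s fun i => g (X i ω) - ∫ x, g x ∂P).symm
    simp only [Set.mem_ofPred_eq, he] at hω
    simp only [Set.mem_union, Set.mem_ofPred_eq, Pi.neg_apply, Finset.sum_neg_distrib]
    exact le_abs.1 hω
  rw [← ofReal_measureReal]
  refine ENNReal.ofReal_le_ofReal ?_
  calc _ ≤ _ := measureReal_mono hset
    _ ≤ _ := measureReal_union_le _ _
    _ ≤ 2 * Real.exp (-u) + 2 * Real.exp (-u) := add_le_add (hup.trans hexp) (hlo.trans hexp)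
    _ = 4 * Real.exp (-u) := by ring

end Sample

/-! ### Nets of the unit ball. -/

/-- The unit ball of a finite-dimensional space has `2⁻ᵐ`-nets of at most exponential cardinality
in `m`; they may be taken in the ball of radius two. -/
theorem exists_finset_net_closedBall (V : Type*) [NormedAddCommGroup V] [NormedSpace ℝ V]
    [FiniteDimensional ℝ V] :
    ∃ (R : ℕ) (F : ℕ → Finset V), F 0 = {0} ∧ ∀ m, (F m).card ≤ R ^ m ∧
      (∀ s ∈ F m, ‖s‖ ≤ 2) ∧ ∀ t : V, ‖t‖ ≤ 1 → ∃ s ∈ F m, ‖t - s‖ ≤ (1 / 2) ^ m := by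
  classical
  obtain ⟨C, hC1, hCfin, hCcov⟩ := 
    (isCompact_closedBall (0 : V) 1).finite_cover_balls (e := 1 / 2) (by norm_num)
  lift C to Finset V using hCfin
  have hcov : ∀ t : V, ‖t‖ ≤ 1 → ∃ c ∈ C, ‖t - c‖ ≤ 1 / 2 := by
    intro t ht
    obtain ⟨c, hc, htc⟩ := Set.mem_iUnion₂.1 (hCcov (mem_closedBall_zero_iff.2 ht))
    exact ⟨c, hc, by rw [← dist_eq_norm]; exact (Metric.mem_ball.1 htc).le⟩
  -- Self-similar refinement: each point of level `m` is replaced by a copy of `C` scaled by `2⁻ᵐ`,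
  -- which halves the mesh and multiplies the cardinality by at most `C.card`.
  let F : ℕ → Finset V := fun m => Nat.rec {0}
    (fun m S => (S ×ˢ C).image fun q => q.1 + ((1 / 2 : ℝ) ^ m) • q.2) m
  have hF : ∀ m, F (m + 1) = (F m ×ˢ C).image fun q => q.1 + ((1 / 2 : ℝ) ^ m) • q.2 :=
    fun m => rfl
  -- The norm bound is the total step length `1 + 1/2 + ⋯ + 2⁻⁽ᵐ⁻¹⁾`.
  have key : ∀ m, (F m).card ≤ C.card ^ m ∧ (∀ s ∈ F m, ‖s‖ ≤ 2 - 2 * (1 / 2) ^ m) ∧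
      ∀ t : V, ‖t‖ ≤ 1 → ∃ s ∈ F m, ‖t - s‖ ≤ (1 / 2) ^ m := by
    intro m
    induction m with
    | zero => refine ⟨by simp [F], by simp [F], fun t ht => ⟨0, by simp [F], by simpa using ht⟩⟩
    | succ m ih =>
      obtain ⟨h1, h2, h3⟩ := ih
      have hpos : (0 : ℝ) < (1 / 2) ^ m := by positivity
      rw [hF]
      refine ⟨?_, ?_, ?_⟩
      · refine Finset.card_image_le.trans ?_
        rw [Finset.card_product, pow_succ]
        gcongr
      · intro s hs
        obtain ⟨q, hq, rfl⟩ := Finset.mem_image.1 hs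
        obtain ⟨hq1, hq2⟩ := Finset.mem_product.1 hq
        have hc : ‖q.2‖ ≤ 1 := mem_closedBall_zero_iff.1 (hC1 hq2)
        refine (norm_add_le _ _).trans ?_
        rw [norm_smul, Real.norm_of_nonneg hpos.le, pow_succ]
        nlinarith [h2 _ hq1]
      · intro t ht
        obtain ⟨s, hs, hts⟩ := h3 t ht
        obtain ⟨c, hc, htc⟩ := hcov (((1 / 2 : ℝ) ^ m)⁻¹ • (t - s)) (by
          rw [norm_smul, norm_inv, Real.norm_of_nonneg hpos.le, inv_mul_le_iff₀ hpos]
          simpa using hts)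
        refine ⟨s + ((1 / 2 : ℝ) ^ m) • c,
          Finset.mem_image.2 ⟨(s, c), Finset.mem_product.2 ⟨hs, hc⟩, rfl⟩, ?_⟩
        have he : t - (s + ((1 / 2 : ℝ) ^ m) • c) =
            ((1 / 2 : ℝ) ^ m) • (((1 / 2 : ℝ) ^ m)⁻¹ • (t - s) - c) := by
          rw [smul_sub, smul_inv_smul₀ hpos.ne']
          abel
        rw [he, norm_smul, Real.norm_of_nonneg hpos.le, pow_succ]
        gcongr
  refine ⟨C.card, F, rfl, fun m => ⟨(key m).1, fun s hs => ?_, (key m).2.2⟩⟩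
  have : (0 : ℝ) < (1 / 2) ^ m := by positivity
  linarith [(key m).2.1 s hs]

/-! ### Uniform deviations by chaining. -/

section Chaining

/-- The centred sum `∑ i ∈ s, (f (X i) - ∫ f dP)`. -/
noncomputable def centeredSum {Ω E ι : Type*} [MeasurableSpace E] (P : Measure E) (s : Finset ι)
    (X : ι → Ω → E) (f : E → ℝ) (ω : Ω) : ℝ :=
  ∑ i ∈ s, (f (X i ω) - ∫ x, f x ∂P)

variable {Ω E ι : Type*} [MeasurableSpace E] {P : Measure E}

theorem centeredSum_sub (s : Finset ι) (X : ι → Ω → E) {f g : E → ℝ} (hf : Integrable f P)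
    (hg : Integrable g P) (ω : Ω) :
    centeredSum P s X (fun x => f x - g x) ω = centeredSum P s X f ω - centeredSum P s X g ω := by
  simp only [centeredSum, integral_sub hf hg, ← Finset.sum_sub_distrib]
  exact Finset.sum_congr rfl fun i _ => by ring

theorem abs_centeredSum_le [IsProbabilityMeasure P] {s : Finset ι} {X : ι → Ω → E} {f : E → ℝ}
    {A : Set E} (hA : ∀ᵐ x ∂P, x ∈ A) {a : ℝ} (hf : ∀ x ∈ A, |f x| ≤ a) {ω : Ω}
    (hω : ∀ i ∈ s, X i ω ∈ A) :
    |centeredSum P s X f ω| ≤ s.card * (2 * a) := by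
  have hint : |∫ x, f x ∂P| ≤ a := by
    have := norm_integral_le_of_norm_le_const (μ := P) (f := f) (C := a)
      (hA.mono fun x hx => hf x hx)
    simpa using this
  refine (Finset.abs_sum_le_sum_abs _ _).trans ?_
  rw [← nsmul_eq_mul]
  refine Finset.sum_le_card_nsmul _ _ _ fun i hi => (abs_sub _ _).trans ?_
  linarith [hf _ (hω i hi)]

theorem sum_range_geometric_mul_add_le {v c : ℝ} (hv : 0 ≤ v) (hc : 0 ≤ c) (m : ℕ) :
    ∑ j ∈ Finset.range m, (1 / 2 : ℝ) ^ j * (v + j * c) ≤ 2 * v + 2 * c := by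
  have h1 : HasSum (fun j : ℕ => (1 / 2 : ℝ) ^ j) 2 := by
    convert hasSum_geometric_of_lt_one (r := (1 / 2 : ℝ)) (by norm_num) (by norm_num) using 1
    norm_num
  have h2 : HasSum (fun j : ℕ => (j : ℝ) * (1 / 2 : ℝ) ^ j) 2 := by
    have := hasSum_coe_mul_geometric_of_norm_lt_one (r := (1 / 2 : ℝ)) (by norm_num)
    norm_num at this ⊢
    exact this
  have h := (h1.mul_right v).add (h2.mul_right c)
  refine le_trans (le_of_eq (Finset.sum_congr rfl fun j _ => ?_))
    (sum_le_hasSum (Finset.range m) (fun j _ => by positivity) h)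
  ring

/-- Uniform deviations of a family of functions that depends in a Lipschitz way on a parameter in
the unit ball of a finite-dimensional space: they are of order `√n`, by chaining. -/
theorem exists_uniform_centeredSum_bound [MeasurableSpace Ω] (μ : Measure Ω) [IsProbabilityMeasure μ]
    [IsProbabilityMeasure P]
    {V : Type*} [NormedAddCommGroup V] [NormedSpace ℝ V] [FiniteDimensional ℝ V]
    {f : V → E → ℝ} (hf : ∀ t, Measurable (f t)) {A : Set E} (hA : ∀ᵐ x ∂P, x ∈ A)
    {K : ℝ} (hK : 0 < K) (hf0 : ∀ x ∈ A, |f 0 x| ≤ K)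
    (hfK : ∀ s t : V, ‖s‖ ≤ 2 → ‖t‖ ≤ 2 → ∀ x ∈ A, |f s x - f t x| ≤ K * ‖s - t‖)
    {ε : ℝ} (hε : 0 < ε) :
    ∃ C : ℝ, 0 < C ∧ ∀ {ι : Type} (s : Finset ι) (X : ι → Ω → E), s.Nonempty →
      IsIIDOn μ P s X →
      μ {ω | ∃ t : V, ‖t‖ ≤ 1 ∧ C * √s.card < |centeredSum P s X (f t) ω|} ≤
        ENNReal.ofReal ε := by
  obtain ⟨R₀, F, hF0, hF⟩ := exists_finset_net_closedBall V
  set R : ℝ := R₀ + 1 with hR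
  have hR1 : 1 ≤ R := by simp [hR]
  -- Level `m` has at most `R * R ^ (3 * m)` links. With threshold `v + m * log q`, each fails with
  -- probability at most `4 * exp (-v) * q ^ (-m)`, so the union bound leaves a summable `2⁻ᵐ`.
  set q : ℝ := 2 * R ^ 3 with hq
  have hq1 : 1 ≤ q := by nlinarith [one_le_pow₀ hR1 (n := 3)]
  have hlq : 0 ≤ Real.log q := Real.log_nonneg hq1
  -- The total failure probability is `4 * exp (-v)` at the root plus `8 * R * exp (-v)` over all
  -- levels, hence at most `12 * R * exp (-v) ≤ ε`.
  set v : ℝ := Real.log (12 * R / ε + 1) with hv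
  have hv0 : 0 ≤ v := Real.log_nonneg (by simp; positivity)
  have hev : Real.exp (-v) * (12 * R) ≤ ε := by
    rw [Real.exp_neg, hv, Real.exp_log (by positivity), inv_mul_le_iff₀ (by positivity)]
    field_simp
    linarith
  have hint : ∀ t : V, ‖t‖ ≤ 2 → Integrable (f t) P := by
    intro t ht
    refine Integrable.of_bound (hf t).aestronglyMeasurable (K + K * 2) (hA.mono fun x hx => ?_)
    have h1 := hfK t 0 ht (by simp) x hx
    have h2 := hf0 x hx
    rw [sub_zero] at h1
    have h3 : K * ‖t‖ ≤ K * 2 := by gcongr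
    rw [Real.norm_eq_abs]
    rw [abs_le] at *
    constructor <;> linarith
  -- Root threshold plus the sum of all link thresholds; the final `1` makes the constant positive.
  refine ⟨K * v + 2 * K * (2 * v + 2 * Real.log q) + 1, by positivity, ?_⟩
  intro ι s X hs hX
  set C : ℝ := K * v + 2 * K * (2 * v + 2 * Real.log q) + 1 with hC
  set D₀ : Set Ω := {ω | K * v * √s.card ≤ |centeredSum P s X (f 0) ω|} with hD₀
  set D : ℕ → V × V → Set Ω := fun m r => {ω | ‖r.1 - r.2‖ ≤ 2 * (1 / 2) ^ m ∧
    (K * (2 * (1 / 2) ^ m)) * (v + m * Real.log q) * √s.card ≤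
      |centeredSum P s X (fun x => f r.1 x - f r.2 x) ω|} with hD
  have hD₀le : μ D₀ ≤ ENNReal.ofReal (4 * Real.exp (-v)) :=
    hX.measure_le_abs_sum_sub_integral_le hs (hf 0) hK (hA.mono hf0) hv0
  have hDle : ∀ m, ∀ r ∈ F m ×ˢ F (m + 1),
      μ (D m r) ≤ ENNReal.ofReal (4 * Real.exp (-(v + m * Real.log q))) := by
    intro m r hr
    obtain ⟨hr1, hr2⟩ := Finset.mem_product.1 hr
    by_cases hd : ‖r.1 - r.2‖ ≤ 2 * (1 / 2) ^ m
    · refine (measure_mono fun ω hω => hω.2).trans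
        (hX.measure_le_abs_sum_sub_integral_le hs ((hf r.1).sub (hf r.2))
          (a := K * (2 * (1 / 2) ^ m)) (by positivity) (hA.mono fun x hx => ?_) (by positivity))
      exact (hfK _ _ ((hF m).2.1 _ hr1) ((hF (m + 1)).2.1 _ hr2) x hx).trans (by gcongr)
    · have : D m r = ∅ := Set.eq_empty_of_forall_notMem fun ω hω => hd hω.1
      simp [this]
  have hlevel : ∀ m, μ (⋃ r ∈ F m ×ˢ F (m + 1), D m r) ≤
      ENNReal.ofReal (4 * R * Real.exp (-v) * (1 / 2) ^ m) := by
    intro m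
    refine (measure_biUnion_finset_le _ _).trans ((Finset.sum_le_sum (hDle m)).trans ?_)
    rw [Finset.sum_const, nsmul_eq_mul, ← ENNReal.ofReal_natCast,
      ← ENNReal.ofReal_mul (by positivity)]
    refine ENNReal.ofReal_le_ofReal ?_
    have hcard : (((F m ×ˢ F (m + 1)).card : ℕ) : ℝ) ≤ R * (R ^ 3) ^ m := by
      rw [Finset.card_product]
      have h1 : ((F m).card : ℝ) ≤ R ^ m :=
        (Nat.cast_le.2 (hF m).1).trans (by push_cast; gcongr; simp [hR])
      have h2 : ((F (m + 1)).card : ℝ) ≤ R ^ (m + 1) :=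
        (Nat.cast_le.2 (hF (m + 1)).1).trans (by push_cast; gcongr; simp [hR])
      push_cast
      calc ((F m).card : ℝ) * (F (m + 1)).card ≤ R ^ m * R ^ (m + 1) := by gcongr
        _ ≤ R ^ m * R ^ (m + 1) * R ^ m :=
          le_mul_of_one_le_right (by positivity) (one_le_pow₀ hR1)
        _ = R * (R ^ 3) ^ m := by
          rw [← pow_add, ← pow_add, ← pow_mul, ← pow_succ']
          congr 1
          omega
    have hexp : Real.exp (-(v + m * Real.log q)) = Real.exp (-v) * (q ^ m)⁻¹ := by
      rw [neg_add, Real.exp_add, ← Real.log_pow, Real.exp_neg (Real.log (q ^ m)),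
        Real.exp_log (by positivity : 0 < q ^ m)]
    rw [hexp, hq, mul_pow]
    calc _ ≤ R * (R ^ 3) ^ m * (4 * (Real.exp (-v) * (2 ^ m * (R ^ 3) ^ m)⁻¹)) := by gcongr
      _ = 4 * R * Real.exp (-v) * (1 / 2) ^ m := by
        rw [one_div, inv_pow]
        field_simp
  have hall : μ (⋃ m, ⋃ r ∈ F m ×ˢ F (m + 1), D m r) ≤
      ENNReal.ofReal (8 * R * Real.exp (-v)) := by
    refine (measure_iUnion_le _).trans ((ENNReal.tsum_le_tsum hlevel).trans ?_)
    rw [← ENNReal.ofReal_tsum_of_nonneg (fun m => by positivity)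
      (summable_geometric_two.mul_left _), tsum_mul_left, tsum_geometric_two]
    exact ENNReal.ofReal_le_ofReal (by linarith)
  have hN : μ {ω | ¬ ∀ i ∈ s, X i ω ∈ A} = 0 := hX.ae_mem hA
  have hcover : {ω | ∃ t : V, ‖t‖ ≤ 1 ∧ C * √s.card < |centeredSum P s X (f t) ω|} ⊆
      {ω | ¬ ∀ i ∈ s, X i ω ∈ A} ∪ (D₀ ∪ ⋃ m, ⋃ r ∈ F m ×ˢ F (m + 1), D m r) := by
    rintro ω ⟨t, ht, hCt⟩
    by_contra hω
    simp only [Set.mem_union, not_or, Set.mem_ofPred_eq, not_not] at hω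
    obtain ⟨hωA, hω0, hωD⟩ := hω
    choose w hwF hwt using fun m => (hF m).2.2 t ht
    have hw2 : ∀ m, ‖w m‖ ≤ 2 := fun m => (hF m).2.1 _ (hwF m)
    have hstep : ∀ m, |centeredSum P s X (f (w m)) ω - centeredSum P s X (f (w (m + 1))) ω| ≤
        2 * K * √s.card * ((1 / 2) ^ m * (v + m * Real.log q)) := by
      intro m
      rw [← centeredSum_sub s X (hint _ (hw2 m)) (hint _ (hw2 (m + 1)))]
      by_contra! hlt
      refine hωD (Set.mem_iUnion.2 ⟨m, Set.mem_iUnion₂.2 ⟨(w m, w (m + 1)),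
        Finset.mem_product.2 ⟨hwF m, hwF (m + 1)⟩, ?_, ?_⟩⟩)
      · have h1 : ‖w m - w (m + 1)‖ ≤ ‖t - w m‖ + ‖t - w (m + 1)‖ := by
          rw [norm_sub_rev t (w m), ← dist_eq_norm, ← dist_eq_norm, ← dist_eq_norm]
          exact dist_triangle _ _ _
        have h2 := hwt (m + 1)
        rw [pow_succ] at h2
        have h3 : (0 : ℝ) < (1 / 2) ^ m := by positivity
        linarith [hwt m]
      · refine le_trans (le_of_eq ?_) hlt.le
        ring
    have hpartial : ∀ m, |centeredSum P s X (f (w m)) ω| ≤ K * v * √s.card +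
        2 * K * √s.card * ∑ j ∈ Finset.range m, (1 / 2 : ℝ) ^ j * (v + j * Real.log q) := by
      intro m
      induction m with
      | zero =>
        have h0 : w 0 = 0 := by simpa [hF0] using hwF 0
        simp only [h0, Finset.range_zero, Finset.sum_empty, mul_zero, add_zero]
        exact (not_le.1 hω0).le
      | succ m ih =>
        rw [Finset.sum_range_succ, mul_add, ← add_assoc]
        have h1 := hstep m
        rw [abs_sub_comm] at h1
        have h2 := abs_sub_abs_le_abs_sub (centeredSum P s X (f (w (m + 1))) ω)
          (centeredSum P s X (f (w m)) ω)
        linarith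
    -- The gap between `t` and its `m`-th approximation is bounded deterministically by the
    -- Lipschitz property; it vanishes as `m → ∞` because the sample is fixed.
    have hlim : ∀ m : ℕ, |centeredSum P s X (f t) ω| ≤ (C - 1) * √s.card +
        s.card * (2 * K) * (1 / 2) ^ m := by
      intro m
      have h1 : |centeredSum P s X (f t) ω - centeredSum P s X (f (w m)) ω| ≤
          s.card * (2 * (K * (1 / 2) ^ m)) := by
        rw [← centeredSum_sub s X (hint _ (by linarith)) (hint _ (hw2 m))]
        exact abs_centeredSum_le hA (fun x hx => (hfK t (w m) (by linarith) (hw2 m) x hx).trans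
          (by gcongr; exact hwt m)) hωA
      have h2 := abs_sub_abs_le_abs_sub (centeredSum P s X (f t) ω)
        (centeredSum P s X (f (w m)) ω)
      have h3 := mul_le_mul_of_nonneg_left (sum_range_geometric_mul_add_le hv0 hlq m)
        (show 0 ≤ 2 * K * √s.card by positivity)
      have h4 := hpartial m
      rw [hC]
      nlinarith
    have hlim' : |centeredSum P s X (f t) ω| ≤ (C - 1) * √s.card + s.card * (2 * K) * 0 :=
      ge_of_tendsto' (((tendsto_pow_atTop_nhds_zero_of_lt_one (by norm_num)
        (by norm_num)).const_mul _).const_add _) hlim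
    have : 0 ≤ √s.card := Real.sqrt_nonneg _
    linarith
  calc _ ≤ _ := measure_mono hcover
    _ ≤ 0 + (ENNReal.ofReal (4 * Real.exp (-v)) + ENNReal.ofReal (8 * R * Real.exp (-v))) :=
      (measure_union_le _ _).trans (add_le_add hN.le
        ((measure_union_le _ _).trans (add_le_add hD₀le hall)))
    _ ≤ ENNReal.ofReal ε := by
      rw [zero_add, ← ENNReal.ofReal_add (by positivity) (by positivity)]
      refine ENNReal.ofReal_le_ofReal ?_
      nlinarith [Real.exp_pos (-v)]

end Chaining

/-! ### Geometry of the cube. -/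

section Cube

variable {p : ℕ}

theorem measurableSet_cube (M : ℝ) : MeasurableSet (cube p M) := by
  have : cube p M = ⋂ i, (fun x : EuclideanSpace ℝ (Fin p) => x i) ⁻¹' Set.Icc (-M) M := by
    ext x
    simp [cube]
  rw [this]
  exact MeasurableSet.iInter fun i =>
    measurableSet_Icc.preimage (by fun_prop : Continuous fun x : EuclideanSpace ℝ (Fin p) => x i).measurable

theorem exists_norm_le_of_mem_cube (p : ℕ) (M : ℝ) :
    ∃ S : ℝ, 0 < S ∧ ∀ x ∈ cube p M, ‖x‖ ≤ S := by
  refine ⟨√(p * M ^ 2) + 1, by positivity, fun x hx => ?_⟩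
  have h : ‖x‖ ≤ √(p * M ^ 2) := by
    rw [EuclideanSpace.norm_eq]
    refine Real.sqrt_le_sqrt ?_
    refine (Finset.sum_le_card_nsmul Finset.univ _ (M ^ 2) fun i _ => ?_).trans (by simp)
    rw [Real.norm_eq_abs, sq_abs]
    exact sq_le_sq' (hx i).1 (hx i).2
  linarith

/-- Clamping the coordinates to `[-M, M]` brings a point closer to every point of the cube. -/
theorem exists_mem_cube_norm_sub_le {M : ℝ} (hne : (cube p M).Nonempty)
    (y : EuclideanSpace ℝ (Fin p)) :
    ∃ z ∈ cube p M, ∀ x ∈ cube p M, ‖x - z‖ ≤ ‖x - y‖ := by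
  obtain ⟨x₀, hx₀⟩ := hne
  refine ⟨WithLp.toLp 2 fun i => max (-M) (min M (y i)), fun i => ⟨by simp, ?_⟩, fun x hx => ?_⟩
  · have := (hx₀ i).1.trans (hx₀ i).2
    simp [this]
  · rw [EuclideanSpace.norm_eq, EuclideanSpace.norm_eq]
    refine Real.sqrt_le_sqrt (Finset.sum_le_sum fun i _ => ?_)
    obtain ⟨h1, h2⟩ := hx i
    simp only [PiLp.sub_apply, Real.norm_eq_abs]
    exact pow_le_pow_left₀ (abs_nonneg _) (by grind) 2

end Cube

/-! ### Regularity of the loss and its uniform deviations. -/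

section Loss

variable {k p : ℕ} {Ψ : (Fin k → ℝ) → ℝ}

theorem clusterLoss_normSq (Ψ : (Fin k → ℝ) → ℝ) (Θ : Fin k → EuclideanSpace ℝ (Fin p))
    (x : EuclideanSpace ℝ (Fin p)) :
    clusterLoss (fun u => ‖u‖ ^ 2) Ψ Θ x = Ψ fun j => ‖x - Θ j‖ ^ 2 := by
  simp only [clusterLoss, bregmanDiv_normSq]

theorem IsAggregation.exists_nonneg_lipschitz (hΨ : IsAggregation Ψ) :
    ∃ τ : ℝ, 0 ≤ τ ∧ ∀ x y, 0 ≤ x → 0 ≤ y → |Ψ x - Ψ y| ≤ τ * ∑ j, |x j - y j| := by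
  obtain ⟨τ, hτ⟩ := hΨ.lipschitz
  refine ⟨max τ 0, le_max_right _ _, fun x y hx hy => (hτ x y hx hy).trans ?_⟩
  gcongr
  exact le_max_left _ _

theorem continuous_clusterLoss_normSq (hΨ : IsAggregation Ψ)
    (Θ : Fin k → EuclideanSpace ℝ (Fin p)) : Continuous (clusterLoss (fun u => ‖u‖ ^ 2) Ψ Θ) := by
  obtain ⟨τ, -, hτ⟩ := hΨ.exists_nonneg_lipschitz
  refine continuous_iff_continuousAt.2 fun x => ?_
  have hlim : Tendsto (fun y => τ * ∑ j, |‖y - Θ j‖ ^ 2 - ‖x - Θ j‖ ^ 2|) (𝓝 x) (𝓝 0) := by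
    have hc : Continuous fun y => τ * ∑ j, |‖y - Θ j‖ ^ 2 - ‖x - Θ j‖ ^ 2| := by fun_prop
    simpa using hc.tendsto x
  refine tendsto_iff_norm_sub_tendsto_zero.2 (squeeze_zero (fun _ => norm_nonneg _)
    (fun y => ?_) hlim)
  rw [clusterLoss_normSq, clusterLoss_normSq, Real.norm_eq_abs]
  exact hτ _ _ (fun j => by positivity) (fun j => by positivity)

/-- On bounded sets the loss is Lipschitz in the centroids, uniformly over the data point. -/
theorem abs_clusterLoss_normSq_sub_le {τ : ℝ} (hτ0 : 0 ≤ τ)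
    (hτ : ∀ x y, 0 ≤ x → 0 ≤ y → |Ψ x - Ψ y| ≤ τ * ∑ j, |x j - y j|) {r : ℝ}
    {x : EuclideanSpace ℝ (Fin p)} (hx : ‖x‖ ≤ r) {Θ Θ' : Fin k → EuclideanSpace ℝ (Fin p)}
    (hΘ : ‖Θ‖ ≤ r) (hΘ' : ‖Θ'‖ ≤ r) :
    |clusterLoss (fun u => ‖u‖ ^ 2) Ψ Θ x - clusterLoss (fun u => ‖u‖ ^ 2) Ψ Θ' x| ≤
      τ * (k * (4 * r)) * ‖Θ - Θ'‖ := by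
  rw [clusterLoss_normSq, clusterLoss_normSq, mul_assoc]
  refine (hτ _ _ (fun j => by positivity) (fun j => by positivity)).trans
    (mul_le_mul_of_nonneg_left ?_ hτ0)
  refine (Finset.sum_le_card_nsmul Finset.univ _ (4 * r * ‖Θ - Θ'‖) fun j _ => ?_).trans
    (by simp [mul_assoc])
  have h1 : |‖x - Θ j‖ - ‖x - Θ' j‖| ≤ ‖Θ - Θ'‖ := by
    refine (abs_norm_sub_norm_le _ _).trans ?_
    rw [sub_sub_sub_cancel_left, norm_sub_rev]
    exact norm_le_pi_norm (Θ - Θ') j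
  have h2 : ‖x - Θ j‖ ≤ r + r := (norm_sub_le _ _).trans
    (add_le_add hx ((norm_le_pi_norm Θ j).trans hΘ))
  have h3 : ‖x - Θ' j‖ ≤ r + r := (norm_sub_le _ _).trans
    (add_le_add hx ((norm_le_pi_norm Θ' j).trans hΘ'))
  rw [sq_sub_sq, abs_mul, abs_of_nonneg (by positivity : 0 ≤ ‖x - Θ j‖ + ‖x - Θ' j‖)]
  have : 0 ≤ r := (norm_nonneg _).trans hx
  gcongr
  linarith

theorem abs_clusterLoss_normSq_zero_le {τ : ℝ} (hτ0 : 0 ≤ τ) (hΨ : IsAggregation Ψ)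
    (hτ : ∀ x y, 0 ≤ x → 0 ≤ y → |Ψ x - Ψ y| ≤ τ * ∑ j, |x j - y j|) {r : ℝ}
    {x : EuclideanSpace ℝ (Fin p)} (hx : ‖x‖ ≤ r) :
    |clusterLoss (fun u => ‖u‖ ^ 2) Ψ 0 x| ≤ τ * (k * r ^ 2) := by
  have h := hτ (fun j => ‖x - (0 : Fin k → EuclideanSpace ℝ (Fin p)) j‖ ^ 2) 0
    (fun j => by positivity) le_rfl
  rw [clusterLoss_normSq]
  rw [hΨ.zero, sub_zero] at h
  refine h.trans (mul_le_mul_of_nonneg_left ?_ hτ0)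
  refine (Finset.sum_le_card_nsmul Finset.univ _ (r ^ 2) fun j _ => ?_).trans (by simp)
  simp only [Pi.zero_apply, sub_zero, abs_pow, abs_norm]
  gcongr

variable {M : ℝ} {P : Measure (EuclideanSpace ℝ (Fin p))} [IsProbabilityMeasure P]

theorem integrable_clusterLoss_normSq (hP : ∀ᵐ x ∂P, x ∈ cube p M) (hΨ : IsAggregation Ψ)
    (Θ : Fin k → EuclideanSpace ℝ (Fin p)) :
    Integrable (clusterLoss (fun u => ‖u‖ ^ 2) Ψ Θ) P := by
  obtain ⟨τ, hτ0, hτ⟩ := hΨ.exists_nonneg_lipschitz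
  obtain ⟨S, hS, hcube⟩ := exists_norm_le_of_mem_cube p M
  set r := max S ‖Θ‖
  refine Integrable.of_bound (continuous_clusterLoss_normSq hΨ Θ).aestronglyMeasurable
    (τ * (k * (4 * r)) * ‖Θ - 0‖ + τ * (k * r ^ 2)) (hP.mono fun x hx => ?_)
  have hxr : ‖x‖ ≤ r := (hcube x hx).trans (le_max_left _ _)
  have h1 := abs_clusterLoss_normSq_sub_le hτ0 hτ hxr (le_max_right S ‖Θ‖)
    (Θ' := 0) (by rw [norm_zero]; exact (norm_nonneg _).trans hxr)
  have h2 := abs_clusterLoss_normSq_zero_le hτ0 hΨ hτ hxr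
  rw [Real.norm_eq_abs]
  have h3 := abs_sub_abs_le_abs_sub (clusterLoss (fun u => ‖u‖ ^ 2) Ψ Θ x)
    (clusterLoss (fun u => ‖u‖ ^ 2) Ψ 0 x)
  linarith

/-- Some system of centroids in the cube is at least as good as a given one. -/
theorem exists_mem_cube_populationRisk_le (hP : ∀ᵐ x ∂P, x ∈ cube p M) (hΨ : IsAggregation Ψ)
    (Θ : Fin k → EuclideanSpace ℝ (Fin p)) :
    ∃ Θ' : Fin k → EuclideanSpace ℝ (Fin p), (∀ j, Θ' j ∈ cube p M) ∧
      populationRisk P (fun u => ‖u‖ ^ 2) Ψ Θ' ≤ populationRisk P (fun u => ‖u‖ ^ 2) Ψ Θ := by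
  choose Θ' hΘ' hle using fun j => exists_mem_cube_norm_sub_le hP.exists (Θ j)
  refine ⟨Θ', hΘ', integral_mono_of_nonneg (Eventually.of_forall fun x => ?_)
    (integrable_clusterLoss_normSq hP hΨ Θ) (hP.mono fun x hx => ?_)⟩
  · simp only [clusterLoss_normSq]
    exact hΨ.nonneg _ fun j => by positivity
  · simp only [clusterLoss_normSq]
    refine hΨ.mono _ _ (fun j => by positivity) fun j => ?_
    have := hle j x hx
    dsimp only
    gcongr

/-- Scaling by a norm bound `S` of the cube puts the centroids in the unit ball of the sup-norm
product. The nets reach norm 2, so the Lipschitz bound is used with radius `2 * S`. -/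
theorem exists_uniform_centeredSum_clusterLoss_bound {Ω : Type*} [MeasurableSpace Ω]
    (μ : Measure Ω) [IsProbabilityMeasure μ] (hP : ∀ᵐ x ∂P, x ∈ cube p M)
    (hΨ : IsAggregation Ψ) {ε : ℝ} (hε : 0 < ε) :
    ∃ C : ℝ, 0 < C ∧ ∀ {ι : Type} (s : Finset ι) (X : ι → Ω → EuclideanSpace ℝ (Fin p)),
      s.Nonempty → IsIIDOn μ P s X →
      μ {ω | ∃ Θ : Fin k → EuclideanSpace ℝ (Fin p), (∀ j, Θ j ∈ cube p M) ∧
        C * √s.card < |centeredSum P s X (clusterLoss (fun u => ‖u‖ ^ 2) Ψ Θ) ω|} ≤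
        ENNReal.ofReal ε := by
  obtain ⟨τ, hτ0, hτ⟩ := hΨ.exists_nonneg_lipschitz
  obtain ⟨S, hS, hcube⟩ := exists_norm_le_of_mem_cube p M
  obtain ⟨C, hC, h⟩ := exists_uniform_centeredSum_bound μ
    (f := fun t : Fin k → EuclideanSpace ℝ (Fin p) => clusterLoss (fun u => ‖u‖ ^ 2) Ψ (S • t))
    (fun t => (continuous_clusterLoss_normSq hΨ _).measurable) hP
    (K := τ * (k * S ^ 2) + τ * (k * (4 * (2 * S))) * S + 1) (by positivity)
    (fun x hx => by
      rw [smul_zero]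
      refine (abs_clusterLoss_normSq_zero_le hτ0 hΨ hτ (hcube x hx)).trans ?_
      have : 0 ≤ τ * (k * (4 * (2 * S))) * S := by positivity
      linarith)
    (fun s t hs ht x hx => by
      have hn : ∀ t : Fin k → EuclideanSpace ℝ (Fin p), ‖S • t‖ = S * ‖t‖ := fun t => by
        rw [norm_smul, Real.norm_of_nonneg hS.le]
      refine (abs_clusterLoss_normSq_sub_le hτ0 hτ (r := 2 * S) (by linarith [hcube x hx])
        (by rw [hn]; nlinarith) (by rw [hn]; nlinarith)).trans ?_
      rw [← smul_sub, hn, ← mul_assoc]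
      gcongr
      have : 0 ≤ τ * (k * S ^ 2) := by positivity
      linarith) hε
  refine ⟨C, hC, fun s X hs hX => (measure_mono ?_).trans (h s X hs hX)⟩
  rintro ω ⟨Θ, hΘ, hlt⟩
  refine ⟨S⁻¹ • Θ, ?_, ?_⟩
  · rw [norm_smul, norm_inv, Real.norm_of_nonneg hS.le, inv_mul_le_iff₀ hS, mul_one]
    exact (pi_norm_le_iff_of_nonneg hS.le).2 fun j => hcube _ (hΘ j)
  · rwa [smul_inv_smul₀ hS.ne']

end Loss

/-! ### From single blocks to the median of means. -/

/-- Disjoint blocks contain at most as many corrupted blocks as there are outliers. -/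
theorem IsBlocking.card_filter_not_subset_le {n L : ℕ} {B : Fin L → Finset (Fin n)}
    (hB : IsBlocking B) (I : Finset (Fin n)) :
    (Finset.univ.filter fun l => ¬ B l ⊆ I).card ≤ Iᶜ.card := by
  classical
  have h : ∀ l : Fin L, ¬ B l ⊆ I → ∃ i ∈ B l, i ∉ I := fun l hl => Finset.not_subset.1 hl
  choose g hgB hgI using h
  rw [← Fintype.card_subtype, ← Fintype.card_coe]
  refine Fintype.card_le_of_injective (fun l : {l // ¬ B l ⊆ I} =>
    (⟨g l l.2, Finset.mem_compl.2 (hgI l l.2)⟩ : (Iᶜ : Finset (Fin n)))) fun l m hlm => ?_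
  by_contra hne
  have hlm' : g l l.2 = g m m.2 := congrArg Subtype.val hlm
  exact Finset.disjoint_left.1 (hB.disjoint fun h => hne (Subtype.ext h)) (hgB l l.2)
    (hlm' ▸ hgB m m.2)

section MedianOfMeans

variable {Ω : Type*} [MeasurableSpace Ω] {μ : Measure Ω} {k p : ℕ} {M : ℝ}
  {P : Measure (EuclideanSpace ℝ (Fin p))} {φ : EuclideanSpace ℝ (Fin p) → ℝ}
  {Ψ : (Fin k → ℝ) → ℝ}

/-- If uniform deviations over a single block of inliers are unlikely, then so are uniform
deviations of the median of means, as the outliers spoil less than half of the blocks. -/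
theorem measure_exists_lt_abs_medianOfMeans_sub_le {n L : ℕ}
    {X : Fin n → Ω → EuclideanSpace ℝ (Fin p)} {I : Finset (Fin n)} (hX : IsIIDOn μ P I X)
    {B : Fin L → Finset (Fin n)} (hB : IsBlocking B) (hL : 0 < L) (hb : 0 < n / L)
    {η : ℝ} (hη : 0 < η) (hO : (2 + η) * (Iᶜ.card : ℝ) < L) {C ε : ℝ}
    (hC : ∀ s : Finset (Fin n), s.Nonempty → IsIIDOn μ P s X →
      μ {ω | ∃ Θ : Fin k → EuclideanSpace ℝ (Fin p), (∀ j, Θ j ∈ cube p M) ∧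
        C * √s.card < |centeredSum P s X (clusterLoss φ Ψ Θ) ω|} ≤
        ENNReal.ofReal (η / (2 * (2 + η)) * ε)) :
    μ {ω | ∃ Θ : Fin k → EuclideanSpace ℝ (Fin p), (∀ j, Θ j ∈ cube p M) ∧
      C / √((n / L : ℕ) : ℝ) <
        |medianOfMeans φ Ψ B (fun i => X i ω) Θ - populationRisk P φ Ψ Θ|} ≤
      ENNReal.ofReal ε := by
  classical
  set b := n / L with hbdef
  have hb' : (0 : ℝ) < b := by exact_mod_cast hb
  -- Quantifying over `Θ` inside the event gives one event per block that serves every `Θ`; it is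
  -- empty for spoiled blocks.
  let E : Fin L → Set Ω := fun l => {ω | B l ⊆ I ∧
    ∃ Θ : Fin k → EuclideanSpace ℝ (Fin p), (∀ j, Θ j ∈ cube p M) ∧
      C * √(B l).card < |centeredSum P (B l) X (clusterLoss φ Ψ Θ) ω|}
  have hE : ∀ l, μ (E l) ≤ ENNReal.ofReal (η / (2 * (2 + η)) * ε) := by
    intro l
    by_cases hl : B l ⊆ I
    · refine (measure_mono fun ω hω => hω.2).trans (hC (B l) ?_ (hX.subset hl))
      rw [← Finset.card_pos, hB.card_eq]
      exact hb
    · have : E l = ∅ := Set.eq_empty_of_forall_notMem fun ω hω => hl hω.1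
      simp [this]
  refine (measure_mono ?_).trans (measure_le_card_filter_mem_le μ E
    (show 0 < η / (2 * (2 + η)) by positivity) hE (by simpa using hL))
  rintro ω ⟨Θ, hΘ, hlt⟩
  have h1 := le_two_mul_card_of_lt_abs_median_sub _ hlt
  have hsub : (Finset.univ.filter fun l => C / √(b : ℝ) <
      |(1 / ((B l).card : ℝ)) * ∑ i ∈ B l, clusterLoss φ Ψ Θ (X i ω) - populationRisk P φ Ψ Θ|) ⊆
      (Finset.univ.filter fun l => ω ∈ E l) ∪ Finset.univ.filter fun l => ¬ B l ⊆ I := by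
    intro l hl
    have hl' := (Finset.mem_filter.1 hl).2
    by_cases hBI : B l ⊆ I
    · refine Finset.mem_union_left _ (Finset.mem_filter.2 ⟨Finset.mem_univ _, hBI, Θ, hΘ, ?_⟩)
      have he : centeredSum P (B l) X (clusterLoss φ Ψ Θ) ω =
          b * ((1 / ((B l).card : ℝ)) * ∑ i ∈ B l, clusterLoss φ Ψ Θ (X i ω) -
            populationRisk P φ Ψ Θ) := by
        rw [centeredSum, Finset.sum_sub_distrib, Finset.sum_const, hB.card_eq, ← hbdef,
          nsmul_eq_mul, populationRisk]
        field_simp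
      rw [he, abs_mul, abs_of_pos hb', hB.card_eq, ← hbdef]
      rw [hB.card_eq, ← hbdef] at hl'
      refine lt_of_eq_of_lt ?_ (mul_lt_mul_of_pos_left hl' hb')
      have : √(b : ℝ) ≠ 0 := (Real.sqrt_pos.2 hb').ne'
      field_simp
      rw [Real.sq_sqrt hb'.le]
    · exact Finset.mem_union_right _ (Finset.mem_filter.2 ⟨Finset.mem_univ _, hBI⟩)
  have h2 := (Finset.card_le_card hsub).trans (Finset.card_union_le _ _)
  have h3 := hB.card_filter_not_subset_le I
  have h4 : (L : ℝ) ≤ 2 * ((Finset.univ.filter fun l => ω ∈ E l).card + Iᶜ.card) := by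
    exact_mod_cast h1.trans (Nat.mul_le_mul_left 2 (h2.trans (Nat.add_le_add_left h3 _)))
  simp only [Set.mem_ofPred_eq, Fintype.card_fin]
  -- The surplus of bad clean blocks is `L / 2 - L / (2 + η) = η / (2 * (2 + η)) * L`.
  rw [div_mul_eq_mul_div, div_le_iff₀ (by positivity)]
  nlinarith

end MedianOfMeans

/-! ### Rates and the main theorem. -/

/-- Rounding down costs at most a factor two: with `b = n / L ≥ 1`, `n < L * (b + 1) ≤ 2 * L * b`.
-/
theorem inv_sqrt_natDiv_le {n L : ℕ} (hL : 0 < L) (hLn : L ≤ n) :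
    1 / √((n / L : ℕ) : ℝ) ≤ 2 * √((L : ℝ) / n) := by
  have hb : 0 < n / L := Nat.div_pos hLn hL
  have hn : 0 < n := hL.trans_le hLn
  have h : n ≤ 2 * (L * (n / L)) := by
    have h1 := Nat.lt_mul_div_succ n hL
    have h2 : L * (n / L + 1) ≤ L * (2 * (n / L)) := Nat.mul_le_mul_left L (by omega)
    nlinarith
  have h' : (n : ℝ) ≤ 2 * (L * (n / L : ℕ)) := by exact_mod_cast h
  have hb' : (0 : ℝ) < (n / L : ℕ) := by exact_mod_cast hb
  have hn' : (0 : ℝ) < n := by exact_mod_cast hn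
  have h4 : (2 : ℝ) = √4 := by
    rw [show (4 : ℝ) = 2 ^ 2 by norm_num, Real.sqrt_sq (by norm_num)]
  rw [h4, ← Real.sqrt_mul (by norm_num), one_div, ← Real.sqrt_inv]
  refine Real.sqrt_le_sqrt ?_
  rw [inv_le_iff_one_le_mul₀ hb', mul_div_assoc', div_mul_eq_mul_div, le_div_iff₀ hn']
  nlinarith

/-- Convergence in measure from a stochastic bound by a sequence tending to zero. -/
theorem tendstoInMeasure_of_isBigOInProbability {Ω : Type*} [MeasurableSpace Ω] {μ : Measure Ω}
    {Y : ℕ → Ω → ℝ} {c : ℝ} {a : ℕ → ℝ} (h : IsBigOInProbability μ (fun n ω => |Y n ω - c|) a)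
    (ha : Tendsto a atTop (𝓝 0)) : TendstoInMeasure μ Y atTop fun _ => c := by
  rw [tendstoInMeasure_iff_norm]
  intro δ hδ
  refine ENNReal.tendsto_nhds_zero.2 fun ε hε => ?_
  obtain ⟨ε', hε'0, hε'⟩ : ∃ ε' : ℝ, 0 < ε' ∧ ENNReal.ofReal ε' ≤ ε := by
    obtain ⟨r, hr0, hr⟩ := ENNReal.lt_iff_exists_nnreal_btwn.1 hε
    exact ⟨r, by simpa using hr0, by simpa using hr.le⟩
  obtain ⟨C, hC⟩ := h ε' hε'0
  have hlim : Tendsto (fun n => C * |a n|) atTop (𝓝 0) := by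
    simpa using ha.abs.const_mul C
  filter_upwards [hC, hlim.eventually_lt_const hδ] with n hn hn'
  refine (measure_mono fun ω hω => ?_).trans (hn.trans hε')
  simp only [Set.mem_ofPred_eq, abs_abs] at hω ⊢
  exact hn'.trans_le hω

theorem tendsto_max_rate {L : ℕ → ℕ} {I : (n : ℕ) → Finset (Fin n)}
    (hLn : (fun n => (L n : ℝ)) =o[atTop] (fun n : ℕ => (n : ℝ))) :
    Tendsto (fun n => max (√((L n : ℝ) / n)) (√((I n).card : ℝ) / n)) atTop (𝓝 0) := by
  have h1 : Tendsto (fun n => √((L n : ℝ) / n)) atTop (𝓝 0) := by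
    simpa only [Real.sqrt_zero, Function.comp_def] using
      (Real.continuous_sqrt.tendsto 0).comp hLn.tendsto_div_nhds_zero
  have h2 : Tendsto (fun n => √((I n).card : ℝ) / n) atTop (𝓝 0) := by
    have h3 : Tendsto (fun n : ℕ => √(1 / (n : ℝ))) atTop (𝓝 0) := by
      simpa only [Real.sqrt_zero, Function.comp_def] using
        (Real.continuous_sqrt.tendsto 0).comp tendsto_one_div_atTop_nhds_zero_nat
    refine squeeze_zero (fun n => by positivity) (fun n => ?_) h3
    have hc : ((I n).card : ℝ) ≤ n := by
      exact_mod_cast (Finset.card_le_univ (I n)).trans_eq (Fintype.card_fin n)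
    rcases n.eq_zero_or_pos with rfl | hn
    · simp
    · have hn' : (0 : ℝ) < n := by exact_mod_cast hn
      refine (div_le_div_of_nonneg_right (Real.sqrt_le_sqrt hc) hn'.le).trans_eq ?_
      rw [Real.sqrt_div_self, one_div, Real.sqrt_inv]
  simpa using h1.max h2

theorem mainTheorem5 {Ω : Type*} [MeasurableSpace Ω] (μ : Measure Ω) [IsProbabilityMeasure μ]
    {k p : ℕ} (M : ℝ)
    -- the law of the inliers, supported on the cube
    (P : Measure (EuclideanSpace ℝ (Fin p))) [IsProbabilityMeasure P] (hP : P (cube p M) = 1)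
    (φ : EuclideanSpace ℝ (Fin p) → ℝ) (hφ : φ = fun u => ‖u‖ ^ 2)
    (Ψ : (Fin k → ℝ) → ℝ) (hΨ : IsAggregation Ψ)
    -- for each sample size `n`: the data, the inlier indices, and the blocks
    (X : (n : ℕ) → Fin n → Ω → EuclideanSpace ℝ (Fin p))
    (I : (n : ℕ) → Finset (Fin n)) (hX : ∀ n, IsIIDOn μ P (I n) (X n))
    (L : ℕ → ℕ) (B : (n : ℕ) → Fin (L n) → Finset (Fin n)) (hB : ∀ n, IsBlocking (B n))
    -- few outliers, relative to the number of blocks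
    (hO : ∃ η : ℝ, 0 < η ∧ ∀ᶠ n in atTop, (2 + η) * (((I n)ᶜ).card : ℝ) < (L n : ℝ))
    (hL : Tendsto L atTop atTop)
    (hLn : (fun n => (L n : ℝ)) =o[atTop] (fun n : ℕ => (n : ℝ)))
    -- the median-of-means estimator
    (Θhat : ℕ → Ω → Fin k → EuclideanSpace ℝ (Fin p))
    (hmem : ∀ n ω j, Θhat n ω j ∈ cube p M)
    (hmin : ∀ n ω (Θ : Fin k → EuclideanSpace ℝ (Fin p)), (∀ j, Θ j ∈ cube p M) →
      medianOfMeans φ Ψ (B n) (fun i => X n i ω) (Θhat n ω) ≤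
        medianOfMeans φ Ψ (B n) (fun i => X n i ω) Θ)
    -- the population minimizer
    (Θstar : Fin k → EuclideanSpace ℝ (Fin p))
    (hstar : ∀ Θ : Fin k → EuclideanSpace ℝ (Fin p),
      populationRisk P φ Ψ Θstar ≤ populationRisk P φ Ψ Θ) :
    IsBigOInProbability μ
        (fun n ω => |populationRisk P φ Ψ (Θhat n ω) - populationRisk P φ Ψ Θstar|)
        (fun n => max (√((L n : ℝ) / n)) (√((I n).card : ℝ) / n)) ∧
      TendstoInMeasure μ (fun n ω => populationRisk P φ Ψ (Θhat n ω)) atTop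
        (fun _ => populationRisk P φ Ψ Θstar) ∧
      ((∀ η : ℝ, 0 < η → ∃ ε : ℝ, 0 < ε ∧ ∀ Θ : Fin k → EuclideanSpace ℝ (Fin p),
          η < diss Θ Θstar → populationRisk P φ Ψ Θstar + ε < populationRisk P φ Ψ Θ) →
        TendstoInMeasure μ (fun n ω => diss (Θhat n ω) Θstar) atTop (fun _ => (0 : ℝ))) := by
  have hPcube : ∀ᵐ x ∂P, x ∈ cube p M :=
    (mem_ae_iff_prob_eq_one (measurableSet_cube M)).2 hP
  subst hφ
  obtain ⟨η, hη, hO⟩ := hO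
  -- `Θstar` may lie outside the cube, where the minimality of `Θhat` says nothing.
  obtain ⟨Θ', hΘ', hle⟩ := exists_mem_cube_populationRisk_le hPcube hΨ Θstar
  have hrate : IsBigOInProbability μ
      (fun n ω => |populationRisk P (fun u => ‖u‖ ^ 2) Ψ (Θhat n ω) -
        populationRisk P (fun u => ‖u‖ ^ 2) Ψ Θstar|)
      (fun n => max (√((L n : ℝ) / n)) (√((I n).card : ℝ) / n)) := by
    intro ε hε
    obtain ⟨C, hC, hdev⟩ := exists_uniform_centeredSum_clusterLoss_bound μ hPcube hΨ
      (show 0 < η / (2 * (2 + η)) * ε by positivity)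
    -- Two deviations, at `Θhat` and at `Θ'`, each at most `C / √b ≤ 2 * C * √(L / n)`.
    refine ⟨4 * C, ?_⟩
    filter_upwards [hO, hL.eventually_gt_atTop 0, hLn.bound zero_lt_one] with n hOn hL0 hLe
    have hLe' : L n ≤ n := by
      rw [one_mul, Real.norm_natCast, Real.norm_natCast] at hLe
      exact_mod_cast hLe
    refine (measure_mono fun ω hω => ?_).trans (measure_exists_lt_abs_medianOfMeans_sub_le (hX n)
      (hB n) hL0 (Nat.div_pos hLe' hL0) hη hOn fun s hs hsX => hdev s (X n) hs hsX)
    by_contra hcon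
    simp only [Set.mem_ofPred_eq, not_exists, not_and, not_lt] at hcon
    have h1 := abs_le.1 (hcon _ (hmem n ω))
    have h2 := abs_le.1 (hcon _ hΘ')
    have h3 := hmin n ω Θ' hΘ'
    have h4 := hstar (Θhat n ω)
    simp only [Set.mem_ofPred_eq, abs_abs] at hω
    refine absurd hω (not_lt.2 ?_)
    rw [abs_of_nonneg (sub_nonneg.2 h4), abs_of_nonneg (le_max_of_le_left (Real.sqrt_nonneg _))]
    have h5 := mul_le_mul_of_nonneg_left (inv_sqrt_natDiv_le hL0 hLe') hC.le
    rw [mul_one_div] at h5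
    have h6 := mul_le_mul_of_nonneg_left
      (le_max_left (√((L n : ℝ) / n)) (√((I n).card : ℝ) / n)) hC.le
    linarith [h1.1, h2.2]
  have hconv := tendstoInMeasure_of_isBigOInProbability hrate (tendsto_max_rate hLn)
  refine ⟨hrate, hconv, fun hsep => ?_⟩
  rw [tendstoInMeasure_iff_norm] at hconv ⊢
  intro δ hδ
  -- Separation needs a strict inequality, while convergence in measure gives only `δ ≤ diss`;
  -- halving `δ` bridges the two.
  obtain ⟨ε, hε, hsep⟩ := hsep (δ / 2) (by linarith)
  refine tendsto_of_tendsto_of_tendsto_of_le_of_le tendsto_const_nhds (hconv ε hε)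
    (fun _ => zero_le) fun n => measure_mono fun ω hω => ?_
  have hnn : 0 ≤ diss (Θhat n ω) Θstar := Real.iInf_nonneg fun σ => Real.sqrt_nonneg _
  simp only [Set.mem_ofPred_eq, sub_zero, Real.norm_of_nonneg hnn] at hω
  have := hsep (Θhat n ω) (by linarith)
  simp only [Set.mem_ofPred_eq, Real.norm_eq_abs]
  exact le_trans (by linarith) (le_abs_self _)
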